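/- Let $l \ge 0$ be an integer and $n \in \{2l, 2l+1\}$. Let $J_n$ be the $n\times n$ matrix with entries $1$ on the anti-diagonal and $0$ elsewhere, and put $$O_n=\{A\in GL_n(\mathbb C) : A^{T}J_nA=J_n\},\qquad \mathfrak o_n=\{a\in\mathfrak{gl}_n(\mathbb C) : a^{T}J_n+J_na=0\}.$$ Let $B$ be the standard Borel subgroup of $O_n$, that is, the group of upper-triangular matrices in $O_n$. It acts by conjugation on the variety $\mathcal N(2)=\{x\in\mathfrak o_n : x^2=0\}$. A symplectic oriented link pattern (solp) of size $l$ consists of the vertices $1,\dots,l$ together with a collection of oriented arrows between them, each with or without a dot, such that every vertex is touched by at most one arrow and no arrow without a dot is a loop (an arrow from a vertex to itself). An orthogonal oriented link pattern (oolp) of size $l$ is a solp of size $l$ in which, moreover, no arrow with a dot is a loop; thus the oolps of size $l$ are exactly the solps of size $l$ without loops. Then the $B$-orbits in $\mathcal N(2)$ are in bijection with the oolps of size $l$. Explicitly, write $k^*=n-k+1$ and let $E_{a,b}$ denote the elementary $n\times n$ matrices. Assign to an arrow of an oolp, for $1\le i<j\le l$, the matrix * $E_{i,j}-E_{j^*,i^*}$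 for an arrow $j\to i$ without a dot, * $E_{j,i}-E_{i^*,j^*}$ for an arrow $i\to j$ without a dot, * $E_{i,j^*}-E_{j,i^*}$ for an arrow $j\to i$ with a dot, * $E_{j^*,i}-E_{i^*,j}$ for an arrow $i\to j$ with a dot. For every oolp $p$, the sum $x_p$ of the matrices assigned to its arrows lies in $\mathcal N(2)$, and $p\mapsto B\cdot x_p$ is a bijection from the set of oolps of size $l$ onto the set of $B$-orbits in $\mathcal N(2)$. -/

import Mathlib

open Matrix

/-! ### The orthogonal group and Lie algebra of the anti-diagonal form, and its standard Borel -/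

/-- The `n × n` anti-diagonal matrix `J_n` with every anti-diagonal entry equal to `1`
(`i.rev` is the index `i* = n - i + 1` in one-based numbering). -/
def antiDiag (n : ℕ) : Matrix (Fin n) (Fin n) ℂ :=
  Matrix.of fun i j => if j = i.rev then 1 else 0

/-- The orthogonal group `O_n = {A ∈ GL_n(ℂ) | Aᵀ J_n A = J_n}`. -/
def orthGroup (n : ℕ) : Subgroup (GL (Fin n) ℂ) where
  carrier := {A | (A : Matrix (Fin n) (Fin n) ℂ)ᵀ * antiDiag n * A = antiDiag n}
  one_mem' := by simp
  mul_mem' := by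
    intro a b ha hb
    simp only [Set.mem_ofPred_eq, Units.val_mul, Matrix.transpose_mul] at *
    calc _ = (b : Matrix (Fin n) (Fin n) ℂ)ᵀ *
          ((a : Matrix (Fin n) (Fin n) ℂ)ᵀ * antiDiag n * a) * b := by
          simp only [Matrix.mul_assoc]
      _ = _ := by rw [ha, hb]
  inv_mem' := by
    intro a ha
    simp only [Set.mem_ofPred_eq] at *
    have h1 : (a : Matrix (Fin n) (Fin n) ℂ) * (a⁻¹ : GL (Fin n) ℂ) = 1 := by
      rw [← Units.val_mul]; simp
    have h2 : ((a⁻¹ : GL (Fin n) ℂ) : Matrix (Fin n) (Fin n) ℂ)ᵀ *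
        (a : Matrix (Fin n) (Fin n) ℂ)ᵀ = 1 := by
      rw [← Matrix.transpose_mul, h1, Matrix.transpose_one]
    conv_lhs => rw [← ha]
    calc _ = (((a⁻¹ : GL (Fin n) ℂ) : Matrix (Fin n) (Fin n) ℂ)ᵀ *
          (a : Matrix (Fin n) (Fin n) ℂ)ᵀ) * antiDiag n *
          ((a : Matrix (Fin n) (Fin n) ℂ) * (a⁻¹ : GL (Fin n) ℂ)) := by
          simp only [Matrix.mul_assoc]
      _ = _ := by rw [h1, h2, Matrix.one_mul, Matrix.mul_one]

/-- The subgroup of upper-triangular matrices of `GL_n(ℂ)`. -/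
def upperGL (n : ℕ) : Subgroup (GL (Fin n) ℂ) where
  carrier := {A | ∀ i j : Fin n, j < i → (A : Matrix (Fin n) (Fin n) ℂ) i j = 0}
  one_mem' := by
    intro i j h
    simp [h.ne']
  mul_mem' := by
    intro a b ha hb
    have ha' : (a : Matrix (Fin n) (Fin n) ℂ).BlockTriangular id := fun i j h => ha i j h
    have hb' : (b : Matrix (Fin n) (Fin n) ℂ).BlockTriangular id := fun i j h => hb i j h
    exact fun i j h => ha'.mul hb' h
  inv_mem' := by
    intro a ha
    have ha' : (a : Matrix (Fin n) (Fin n) ℂ).BlockTriangular id := fun i j h => ha i j h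
    have : Invertible (a : Matrix (Fin n) (Fin n) ℂ) := a.invertible
    have := Matrix.blockTriangular_inv_of_blockTriangular ha'
    intro i j h
    rw [Matrix.coe_units_inv]
    exact this h

/-- The standard Borel subgroup `B` of `O_n`: the upper-triangular matrices in `O_n`. -/
def orthBorel (n : ℕ) : Subgroup (GL (Fin n) ℂ) := orthGroup n ⊓ upperGL n

/-- (The underlying vector space of) the Lie algebra
`𝔬_n = {a ∈ 𝔤𝔩_n(ℂ) | aᵀ J_n + J_n a = 0}` of `O_n`. -/
def orthLie (n : ℕ) : Submodule ℂ (Matrix (Fin n) (Fin n) ℂ) :=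
  skewAdjointMatricesSubmodule (antiDiag n)

theorem mem_orthLie {n : ℕ} (a : Matrix (Fin n) (Fin n) ℂ) :
    a ∈ orthLie n ↔ aᵀ * antiDiag n + antiDiag n * a = 0 := by
  rw [orthLie, mem_skewAdjointMatricesSubmodule,
    Matrix.IsSkewAdjoint, Matrix.IsAdjointPair, Matrix.mul_neg, eq_neg_iff_add_eq_zero]

/-- The variety `N(2) = {x ∈ 𝔬_n | x² = 0}` of `2`-nilpotent elements of `𝔬_n`. -/
def orthNilTwo (n : ℕ) : Set (Matrix (Fin n) (Fin n) ℂ) := {x | x ∈ orthLie n ∧ x ^ 2 = 0}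

theorem conj_mem_orthNilTwo {n : ℕ} {g : GL (Fin n) ℂ} (hg : g ∈ orthBorel n)
    {x : Matrix (Fin n) (Fin n) ℂ} (hx : x ∈ orthNilTwo n) :
    (g : Matrix (Fin n) (Fin n) ℂ) * x * ((g⁻¹ : GL (Fin n) ℂ) : Matrix (Fin n) (Fin n) ℂ)
      ∈ orthNilTwo n := by
  obtain ⟨hx1, hx2⟩ := hx
  have hgi : ((g⁻¹ : GL (Fin n) ℂ) : Matrix (Fin n) (Fin n) ℂ)ᵀ * antiDiag n *
      ((g⁻¹ : GL (Fin n) ℂ) : Matrix (Fin n) (Fin n) ℂ) = antiDiag n :=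
    (orthGroup n).inv_mem hg.1
  have h1 : ((g⁻¹ : GL (Fin n) ℂ) : Matrix (Fin n) (Fin n) ℂ) * (g : Matrix (Fin n) (Fin n) ℂ)
      = 1 := by
    rw [← Units.val_mul]; simp
  set G : Matrix (Fin n) (Fin n) ℂ := (g : Matrix (Fin n) (Fin n) ℂ)
  set H : Matrix (Fin n) (Fin n) ℂ := ((g⁻¹ : GL (Fin n) ℂ) : Matrix (Fin n) (Fin n) ℂ)
  have h2 : Gᵀ * Hᵀ = 1 := by rw [← Matrix.transpose_mul, h1, Matrix.transpose_one]
  rw [mem_orthLie] at hx1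
  refine ⟨?_, ?_⟩
  · rw [mem_orthLie]
    have e1 : (G * x * H)ᵀ * antiDiag n = Hᵀ * (xᵀ * antiDiag n) * H := by
      conv_lhs => rw [← hgi]
      calc _ = Hᵀ * xᵀ * (Gᵀ * Hᵀ) * antiDiag n * H := by
            simp only [Matrix.transpose_mul, Matrix.mul_assoc]
        _ = _ := by rw [h2, Matrix.mul_one]; simp only [Matrix.mul_assoc]
    have e2 : antiDiag n * (G * x * H) = Hᵀ * (antiDiag n * x) * H := by
      conv_lhs => rw [← hgi]
      calc _ = Hᵀ * antiDiag n * (H * G) * x * H := by simp only [Matrix.mul_assoc]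
        _ = _ := by rw [h1, Matrix.mul_one]; simp only [Matrix.mul_assoc]
    rw [e1, e2, ← Matrix.add_mul, ← Matrix.mul_add, hx1, Matrix.mul_zero, Matrix.zero_mul]
  · calc (G * x * H) ^ 2 = G * x * (H * G) * x * H := by
          rw [pow_two]; simp only [Matrix.mul_assoc]
      _ = G * (x ^ 2) * H := by rw [h1, Matrix.mul_one, pow_two]; simp only [Matrix.mul_assoc]
      _ = 0 := by rw [hx2, Matrix.mul_zero, Matrix.zero_mul]

/-- The action of `B` on `N(2)` by conjugation, `g • x = g x g⁻¹`. -/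
instance orthBorelAction (n : ℕ) : MulAction (orthBorel n) (orthNilTwo n) where
  smul g x := ⟨((g : GL (Fin n) ℂ) : Matrix (Fin n) (Fin n) ℂ) * (x : Matrix (Fin n) (Fin n) ℂ) *
    (((g : GL (Fin n) ℂ)⁻¹ : GL (Fin n) ℂ) : Matrix (Fin n) (Fin n) ℂ),
    conj_mem_orthNilTwo g.2 x.2⟩
  one_smul x := Subtype.ext (by
    change ((1 : GL (Fin n) ℂ) : Matrix (Fin n) (Fin n) ℂ) * (x : Matrix (Fin n) (Fin n) ℂ) *
      (((1 : GL (Fin n) ℂ)⁻¹ : GL (Fin n) ℂ) : Matrix (Fin n) (Fin n) ℂ) = x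
    simp)
  mul_smul g h x := Subtype.ext (by
    change (((g : GL (Fin n) ℂ) * (h : GL (Fin n) ℂ) : GL (Fin n) ℂ) :
        Matrix (Fin n) (Fin n) ℂ) * (x : Matrix (Fin n) (Fin n) ℂ) *
      ((((g : GL (Fin n) ℂ) * (h : GL (Fin n) ℂ))⁻¹ : GL (Fin n) ℂ) :
        Matrix (Fin n) (Fin n) ℂ) =
      ((g : GL (Fin n) ℂ) : Matrix (Fin n) (Fin n) ℂ) *
        (((h : GL (Fin n) ℂ) : Matrix (Fin n) (Fin n) ℂ) * (x : Matrix (Fin n) (Fin n) ℂ) *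
          (((h : GL (Fin n) ℂ)⁻¹ : GL (Fin n) ℂ) : Matrix (Fin n) (Fin n) ℂ)) *
        (((g : GL (Fin n) ℂ)⁻¹ : GL (Fin n) ℂ) : Matrix (Fin n) (Fin n) ℂ)
    rw [_root_.mul_inv_rev, Units.val_mul, Units.val_mul]
    simp only [Matrix.mul_assoc])

/-- The set of `B`-orbits in `N(2) ⊆ 𝔬_n`. -/
abbrev OrthOrbits (n : ℕ) : Type := MulAction.orbitRel.Quotient (orthBorel n) (orthNilTwo n)

/-! ### Oriented link patterns -/

/-- An oriented arrow, with or without a dot, between vertices from a set of `l` vertices. -/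
@[ext]
structure LinkArrow (l : ℕ) where
  source : Fin l
  target : Fin l
  dotted : Bool

/-- The arrow touches the vertex `v`. -/
def LinkArrow.Touches {l : ℕ} (a : LinkArrow l) (v : Fin l) : Prop :=
  a.source = v ∨ a.target = v

/-- A symplectic oriented link pattern of size `l`. -/
@[ext]
structure Solp (l : ℕ) where
  arrows : Finset (LinkArrow l)
  /-- Every vertex is touched by at most one arrow. -/
  touched : ∀ v : Fin l, ∀ a ∈ arrows, ∀ b ∈ arrows, a.Touches v → b.Touches v → a = b
  /-- There are no loops without dots. -/
  no_plain_loop : ∀ a ∈ arrows, a.dotted = false → a.source ≠ a.target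

/-- An orthogonal oriented link pattern of size `l`. -/
@[ext]
structure Oolp (l : ℕ) extends Solp l where
  /-- There are no loops with dots. -/
  no_dotted_loop : ∀ a ∈ arrows, a.dotted = true → a.source ≠ a.target

/-! ### The representative matrices -/

/-- The part of the representative matrix given by an arrow from `s` to `t`, where
`x* = n - x + 1`: it is `E_{t,s} - E_{s*,t*}` for an arrow without dot,
`E_{t*,s} - E_{s*,t}` for a dotted arrow with `s < t`, and
`E_{t,s*} - E_{s,t*}` for a dotted arrow with `t < s`. -/
def LinkArrow.matrix {l n : ℕ} (h : l ≤ n) (a : LinkArrow l) : Matrix (Fin n) (Fin n) ℂ :=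
  let s : Fin n := Fin.castLE h a.source
  let t : Fin n := Fin.castLE h a.target
  if a.dotted = false then
    Matrix.single t s 1 - Matrix.single s.rev t.rev 1
  else if a.source < a.target then
    Matrix.single t.rev s 1 - Matrix.single s.rev t 1
  else
    Matrix.single t s.rev 1 - Matrix.single s t.rev 1

/-- The representative matrix of an orthogonal oriented link pattern: the sum of the parts given
by its arrows (untouched vertices contribute `0`). -/
def Oolp.matrix {l n : ℕ} (h : l ≤ n) (p : Oolp l) : Matrix (Fin n) (Fin n) ℂ :=
  ∑ a ∈ p.arrows, a.matrix h

theorem le_of_eq_two_mul_or {l n : ℕ} (hn : n = 2 * l ∨ n = 2 * l + 1) : l ≤ n := by omega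

/-! ### Entrywise descriptions -/

/-! Existence is an elimination that respects the form. In a nonzero `x` take the first nonzero
column `j` and its last nonzero entry, in row `k`. Since `x` is skew with square zero, its columns
are isotropic, and an isotropic vector led by index `k` is the image of `e_k` under an upper
triangular isometry (`isotropicShear`). One shear turns column `j` into `±e_k`, a second does the
same for the mirror column `k*` (`exists_conj_pivot`). The resulting pair of matrix units splits off
as a summand, and what remains lives on the basis vectors outside `j, j*, k, k*`
(`sub_skewUnit_mem_nilTwoOn`). Later conjugations act only there, so they leave the pair alone
(`borelOn_conj_skewUnit`), and induction on the set of active indices applies. Each pair is, up to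
sign, the matrix of an arrow (`exists_arrow_skewUnit`).

Uniqueness uses only triangularity: pattern matrices have at most one nonzero entry in each row and
column, and the support of such a matrix is invariant under upper triangular conjugation
(`support_iff_of_upper_conj`). The support determines the arrows. -/

theorem antiDiag_mul_apply {n : ℕ} (x : Matrix (Fin n) (Fin n) ℂ) (a b : Fin n) :
    (antiDiag n * x) a b = x a.rev b := by
  simp [Matrix.mul_apply, antiDiag]

theorem mul_antiDiag_apply {n : ℕ} (x : Matrix (Fin n) (Fin n) ℂ) (a b : Fin n) :
    (x * antiDiag n) a b = x a b.rev := by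
  have h : ∀ c : Fin n, b = c.rev ↔ c = b.rev := fun c => by rw [← Fin.rev_eq_iff, eq_comm]
  simp [Matrix.mul_apply, antiDiag, h]

theorem antiDiag_mul_self (n : ℕ) : antiDiag n * antiDiag n = 1 := by
  ext a b
  rw [antiDiag_mul_apply]
  simp [antiDiag, Matrix.one_apply, eq_comm]

theorem mem_orthLie_iff_apply {n : ℕ} {x : Matrix (Fin n) (Fin n) ℂ} :
    x ∈ orthLie n ↔ ∀ a b, x a b = -x b.rev a.rev := by
  rw [mem_orthLie, ← Matrix.ext_iff]
  simp only [Matrix.add_apply, mul_antiDiag_apply, antiDiag_mul_apply, Matrix.transpose_apply,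
    Matrix.zero_apply]
  constructor
  · intro h a b
    have := h a.rev b
    rw [Fin.rev_rev] at this
    linear_combination this
  · intro h a b
    have := h a.rev b
    rw [Fin.rev_rev] at this
    linear_combination this

theorem transpose_mul_antiDiag_mul_iff {n : ℕ} {A : Matrix (Fin n) (Fin n) ℂ} :
    Aᵀ * antiDiag n * A = antiDiag n ↔
      ∀ a b, ∑ c, A c a * A c.rev b = if b = a.rev then 1 else 0 := by
  rw [← Matrix.ext_iff]
  simp only [Matrix.mul_assoc]
  refine forall₂_congr fun a b => ?_
  rw [Matrix.mul_apply]
  simp only [antiDiag_mul_apply, Matrix.transpose_apply]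
  rfl

/-- The unit attached to a matrix preserving the anti-diagonal form. -/
def unitOfOrth {n : ℕ} (A : Matrix (Fin n) (Fin n) ℂ)
    (h : Aᵀ * antiDiag n * A = antiDiag n) : GL (Fin n) ℂ where
  val := A
  inv := antiDiag n * Aᵀ * antiDiag n
  val_inv := by
    rw [_root_.mul_eq_one_comm, Matrix.mul_assoc, Matrix.mul_assoc, ← Matrix.mul_assoc Aᵀ, h,
      antiDiag_mul_self]
  inv_val := by
    rw [Matrix.mul_assoc, Matrix.mul_assoc, ← Matrix.mul_assoc Aᵀ, h, antiDiag_mul_self]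

/-! ### Isotropic vectors -/

/-- If `k = k*`, every term of the form except `u k * u k` involves an index beyond `k`, so isotropy
would force `u k = 0`. This rules out the middle index when `n` is odd. -/
theorem ne_rev_of_isotropic {n : ℕ} {u : Fin n → ℂ} {k : Fin n} (iso : ∑ c, u c * u c.rev = 0)
    (lead : ∀ i, k < i → u i = 0) (hk : u k ≠ 0) : k ≠ k.rev := by
  intro h
  rw [Finset.sum_eq_single k] at iso
  · rw [← h] at iso
    exact hk (mul_self_eq_zero.mp iso)
  · intro c _ hc
    rcases lt_or_gt_of_ne hc with hlt | hgt
    · rw [lead c.rev (by rw [h]; exact Fin.rev_lt_rev.mpr hlt), mul_zero]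
    · rw [lead c hgt, zero_mul]
  · simp

/-- Skewness rewrites the `(i*, i)` entry of `x ^ 2` as minus the form evaluated on column `i`. -/
theorem col_isotropic {n : ℕ} {x : Matrix (Fin n) (Fin n) ℂ} (hx : x ∈ orthNilTwo n) (i : Fin n) :
    ∑ c, x c i * x c.rev i = 0 := by
  have h := congrFun (congrFun hx.2 i.rev) i
  rw [pow_two, Matrix.mul_apply, Matrix.zero_apply] at h
  rw [← neg_eq_zero, ← h, ← Finset.sum_neg_distrib]
  refine Finset.sum_congr rfl fun c _ => ?_
  have := mem_orthLie_iff_apply.mp hx.1 i.rev c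
  rw [Fin.rev_rev] at this
  rw [this]
  ring

/-- An upper triangular isometry sending the basis vector at `k` to the vector `u`. -/
noncomputable def isotropicShear {n : ℕ} (u : Fin n → ℂ) (k : Fin n) : Matrix (Fin n) (Fin n) ℂ :=
  Matrix.of fun c a =>
    if a = k then u c
    else if a = k.rev then (if c = k.rev then (u k)⁻¹ else 0)
    else (if c = a then 1 else 0) - (if c = k.rev then u a.rev / u k else 0)

/-- The columns at `k` and `k*` are `u` and `(u k)⁻¹ e_{k*}`, which pair to `1`. For any other `a`,
the vector `e_a` is corrected by the multiple of `e_{k*}` that makes it orthogonal to `u`; the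
remaining pairings do not change. -/
theorem isotropicShear_orth {n : ℕ} {u : Fin n → ℂ} {k : Fin n} (iso : ∑ c, u c * u c.rev = 0)
    (hk : u k ≠ 0) (hkk : k ≠ k.rev) :
    (isotropicShear u k)ᵀ * antiDiag n * isotropicShear u k = antiDiag n := by
  have hkk' : k.rev ≠ k := hkk.symm
  have e1 : ∀ c d : Fin n, c.rev = d ↔ c = d.rev := fun c d => Fin.rev_eq_iff
  have e2 : ∀ c d : Fin n, c.rev = d.rev ↔ c = d := fun c d => Fin.rev_inj
  rw [transpose_mul_antiDiag_mul_iff]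
  intro a b
  simp only [isotropicShear, Matrix.of_apply]
  by_cases ha : a = k
  · subst ha
    by_cases hb : b = a
    · subst hb
      simp [hkk, iso]
    · by_cases hb' : b = a.rev
      · subst hb'
        simp [hkk', e2, hk]
      · simp only [if_true, hb, hb', if_false, e1, Fin.rev_rev, mul_sub, mul_ite, mul_one,
          mul_zero, Finset.sum_sub_distrib, Finset.sum_ite_eq', Finset.mem_univ]
        field_simp
        ring
  · by_cases ha' : a = k.rev
    · subst ha'
      by_cases hb : b = k
      · subst hb
        simp [hkk', hk]
      · by_cases hb' : b = k.rev
        · subst hb'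
          simp [hkk', hkk, e1]
        · simp [hkk', hb, hb', Ne.symm hb]
    · have ha2 : a.rev ≠ k := fun h => ha' ((e1 _ _).mp h)
      by_cases hb : b = k
      · subst hb
        simp [ha, ha', sub_mul, Ne.symm ha2, Finset.sum_sub_distrib, hk]
      · by_cases hb' : b = k.rev
        · subst hb'
          have : ¬ k = a := fun h => ha h.symm
          simp [ha, ha', hkk', hkk, e1, this, sub_mul]
        · simp [ha, ha', hb, hb', hkk, sub_mul, mul_sub, Finset.sum_sub_distrib, e1, Ne.symm ha]

/-- The elements of the Borel subgroup fixing all basis vectors with index outside of `S`. -/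
def borelOn {n : ℕ} (S : Finset (Fin n)) : Subgroup (GL (Fin n) ℂ) where
  carrier := {A | A ∈ orthBorel n ∧ ∀ i ∉ S,
    (A : Matrix (Fin n) (Fin n) ℂ) *ᵥ Pi.single i 1 = Pi.single i 1}
  one_mem' := ⟨Subgroup.one_mem _, fun i _ => by rw [Units.val_one, Matrix.one_mulVec]⟩
  mul_mem' := fun {a b} ha hb => ⟨Subgroup.mul_mem _ ha.1 hb.1, fun i hi => by
    rw [Units.val_mul, ← Matrix.mulVec_mulVec, hb.2 i hi, ha.2 i hi]⟩
  inv_mem' := fun {a} ha => ⟨Subgroup.inv_mem _ ha.1, fun i hi => by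
    conv_lhs => rw [← ha.2 i hi]
    rw [Matrix.mulVec_mulVec, ← Units.val_mul, inv_mul_cancel, Units.val_one, Matrix.one_mulVec]⟩

theorem borelOn_mono {n : ℕ} {S T : Finset (Fin n)} (h : S ⊆ T) : borelOn S ≤ borelOn T :=
  fun _ hA => ⟨hA.1, fun i hi => hA.2 i fun hS => hi (h hS)⟩

/-- The shear moves `e_i` only if `i` is `k` or `k*` or `u i.rev ≠ 0`; `hS` keeps all such indices
inside `S`. The last conjunct lets later steps check that earlier normalisations survive. -/
theorem exists_borelOn_mulVec_eq {n : ℕ} {S : Finset (Fin n)} {u : Fin n → ℂ}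
    {k : Fin n} (iso : ∑ c, u c * u c.rev = 0) (lead : ∀ i, k < i → u i = 0) (hk : u k ≠ 0)
    (hS : ∀ i ∉ S, i ≠ k ∧ i ≠ k.rev ∧ u i.rev = 0) :
    ∃ A ∈ borelOn S, (A : Matrix (Fin n) (Fin n) ℂ) *ᵥ Pi.single k 1 = u ∧
      (A : Matrix (Fin n) (Fin n) ℂ) *ᵥ Pi.single k.rev 1 = (u k)⁻¹ • Pi.single k.rev 1 ∧
      ∀ i, i ≠ k → i ≠ k.rev → u i.rev = 0 →
        (A : Matrix (Fin n) (Fin n) ℂ) *ᵥ Pi.single i 1 = Pi.single i 1 := by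
  have hkk := ne_rev_of_isotropic iso lead hk
  have fix : ∀ i, i ≠ k → i ≠ k.rev → u i.rev = 0 →
      isotropicShear u k *ᵥ Pi.single i 1 = Pi.single i 1 := by
    intro i h1 h2 h3
    ext c
    simp [isotropicShear, h1, h2, h3, Pi.single_apply]
  refine ⟨unitOfOrth _ (isotropicShear_orth iso hk hkk), ⟨⟨isotropicShear_orth iso hk hkk, ?_⟩,
    fun i hi => ?_⟩, ?_, ?_, fix⟩
  · intro c a hac
    simp only [unitOfOrth, isotropicShear, Matrix.of_apply]
    split_ifs with h1 h2 h3 h4 h5 h6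
    · exact lead c (h1 ▸ hac)
    · omega
    · rfl
    · omega
    · omega
    -- Here the row is `k*` and `a < k*`, so `a*` lies beyond the leading index `k`.
    · have : u a.rev = 0 := by
        apply lead
        rw [← Fin.rev_lt_rev, Fin.rev_rev]
        exact h6 ▸ hac
      simp [this]
    · simp
  · obtain ⟨h1, h2, h3⟩ := hS i hi
    exact fix i h1 h2 h3
  · ext c
    simp [unitOfOrth, isotropicShear]
  · ext c
    simp [unitOfOrth, isotropicShear, hkk.symm, Pi.single_apply]

/-! ### Reduction to normal form -/

/-- The elements of `N(2)` vanishing on all basis vectors with index outside of `S`. -/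
def nilTwoOn {n : ℕ} (S : Finset (Fin n)) : Set (Matrix (Fin n) (Fin n) ℂ) :=
  {x | x ∈ orthNilTwo n ∧ ∀ i ∉ S, x *ᵥ Pi.single i 1 = 0}

theorem conj_mem_nilTwoOn {n : ℕ} {S : Finset (Fin n)} {g : GL (Fin n) ℂ} (hg : g ∈ borelOn S)
    {x : Matrix (Fin n) (Fin n) ℂ} (hx : x ∈ nilTwoOn S) :
    (g : Matrix (Fin n) (Fin n) ℂ) * x * ((g⁻¹ : GL (Fin n) ℂ) : Matrix (Fin n) (Fin n) ℂ)
      ∈ nilTwoOn S := by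
  refine ⟨conj_mem_orthNilTwo hg.1 hx.1, fun i hi => ?_⟩
  rw [← Matrix.mulVec_mulVec, (inv_mem hg).2 i hi, ← Matrix.mulVec_mulVec, hx.2 i hi,
    Matrix.mulVec_zero]

theorem inv_mulVec_eq {n : ℕ} {A : GL (Fin n) ℂ} {v w : Fin n → ℂ}
    (h : (A : Matrix (Fin n) (Fin n) ℂ) *ᵥ v = w) :
    ((A⁻¹ : GL (Fin n) ℂ) : Matrix (Fin n) (Fin n) ℂ) *ᵥ w = v := by
  rw [← h, Matrix.mulVec_mulVec, ← Units.val_mul, inv_mul_cancel, Units.val_one,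
    Matrix.one_mulVec]

theorem mulVec_single_one_eq_zero_iff {n : ℕ} {x : Matrix (Fin n) (Fin n) ℂ} {i : Fin n} :
    x *ᵥ Pi.single i 1 = 0 ↔ ∀ a, x a i = 0 := by
  rw [Matrix.mulVec_single_one]
  exact funext_iff

/-- The first nonzero column of a nonzero element and the last nonzero entry in it. -/
theorem exists_pivot {n : ℕ} {x : Matrix (Fin n) (Fin n) ℂ} (hx : x ≠ 0) :
    ∃ j k, x k j ≠ 0 ∧ (∀ i, i < j → ∀ a, x a i = 0) ∧ ∀ a, k < a → x a j = 0 := by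
  classical
  have h1 : (Finset.univ.filter fun j => ∃ a, x a j ≠ 0).Nonempty := by
    by_contra h
    rw [Finset.not_nonempty_iff_eq_empty, Finset.filter_eq_empty_iff] at h
    refine hx (Matrix.ext fun a j => ?_)
    by_contra h2
    exact h (Finset.mem_univ j) ⟨a, h2⟩
  obtain ⟨j, hj, hjmin⟩ := Finset.exists_minimal h1
  have h2 : (Finset.univ.filter fun k => x k j ≠ 0).Nonempty := by
    obtain ⟨a, ha⟩ := (Finset.mem_filter.mp hj).2
    exact ⟨a, by simpa using ha⟩
  obtain ⟨k, hk, hkmax⟩ := Finset.exists_maximal h2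
  refine ⟨j, k, (Finset.mem_filter.mp hk).2, fun i hij a => ?_, fun a hka => ?_⟩
  · by_contra h
    exact absurd (hjmin (Finset.mem_filter.mpr ⟨Finset.mem_univ _, a, h⟩) hij.le) (not_le.mpr hij)
  · by_contra h
    exact absurd (hkmax (Finset.mem_filter.mpr ⟨Finset.mem_univ _, h⟩) hka.le) (not_le.mpr hka)

/-- The pair of opposite matrix units with pivot at row `k` and column `j`. -/
def skewUnit {n : ℕ} (k j : Fin n) : Matrix (Fin n) (Fin n) ℂ :=
  Matrix.single k j 1 - Matrix.single j.rev k.rev 1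

theorem mem_nilTwoOn_rows {n : ℕ} {S : Finset (Fin n)} (hS : ∀ i ∈ S, i.rev ∈ S)
    {x : Matrix (Fin n) (Fin n) ℂ} (hx : x ∈ nilTwoOn S) {i : Fin n} (hi : i ∉ S) (b : Fin n) :
    x i b = 0 := by
  have h := mem_orthLie_iff_apply.mp hx.1.1 i b
  rw [h, mulVec_single_one_eq_zero_iff.mp (hx.2 i.rev fun h2 => hi ?_), neg_zero]
  simpa using hS _ h2

/-- The anti-diagonal is fixed, up to sign, by the skew symmetry. Hence no pivot sits at `(i*, i)`,
which is why dotted loops do not occur. -/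
theorem apply_rev_self {n : ℕ} {x : Matrix (Fin n) (Fin n) ℂ} (hx : x ∈ orthNilTwo n)
    (i : Fin n) : x i.rev i = 0 := by
  have h := mem_orthLie_iff_apply.mp hx.1 i.rev i
  rw [Fin.rev_rev] at h
  exact self_eq_neg.mp h

theorem pivot_ne {n : ℕ} {x : Matrix (Fin n) (Fin n) ℂ} (hx : x ∈ orthNilTwo n) {j k : Fin n}
    (hjk : x k j ≠ 0) (hj : ∀ i, i < j → ∀ a, x a i = 0) (hk : ∀ a, k < a → x a j = 0) :
    k ≠ j ∧ k ≠ j.rev ∧ k ≠ k.rev ∧ j ≠ j.rev := by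
  refine ⟨?_, ?_, ne_rev_of_isotropic (col_isotropic hx j) hk hjk, fun h => ?_⟩
  · rintro rfl
    have h := congrFun (congrFun hx.2 k) k
    rw [pow_two, Matrix.mul_apply, Finset.sum_eq_single k] at h
    · exact hjk (mul_self_eq_zero.mp h)
    · intro c _ hc
      rcases lt_or_gt_of_ne hc with hlt | hgt
      · rw [hj c hlt, zero_mul]
      · rw [hk c hgt, mul_zero]
    · simp
  · rintro rfl
    exact hjk (apply_rev_self hx j)
  -- The mirror of the pivot lies in column `k*`, row `j*`. It leads that column, because the
  -- entries beyond it mirror columns before `j`.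
  · refine ne_rev_of_isotropic (col_isotropic hx k.rev) (k := j) (fun i hi => ?_) ?_ h
    · rw [mem_orthLie_iff_apply.mp hx.1, hj _ ?_, neg_zero]
      rw [h]
      exact Fin.rev_lt_rev.mpr hi
    · rw [mem_orthLie_iff_apply.mp hx.1, ← h, Fin.rev_rev]
      exact neg_ne_zero.mpr hjk

/-! ### Normalising the pivot column and its mirror -/

theorem exists_conj_first_column {n : ℕ} {S : Finset (Fin n)} (hS : ∀ i ∈ S, i.rev ∈ S)
    {x : Matrix (Fin n) (Fin n) ℂ} (hx : x ∈ nilTwoOn S) {j k : Fin n}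
    (hjk : x k j ≠ 0) (hj : ∀ i, i < j → ∀ a, x a i = 0) (hk : ∀ a, k < a → x a j = 0)
    {ε : ℂ} (hε : ε * ε = 1) :
    ∃ g ∈ borelOn S, ∃ y ∈ nilTwoOn S, y = (g : Matrix (Fin n) (Fin n) ℂ) * x *
        ((g⁻¹ : GL (Fin n) ℂ) : Matrix (Fin n) (Fin n) ℂ) ∧
      y *ᵥ Pi.single j 1 = ε • Pi.single k 1 ∧ ∀ i, i < j → ∀ a, y a i = 0 := by
  have hε0 : ε ≠ 0 := fun h => by simp [h] at hε
  obtain ⟨hkj, hkj', hkk, hjj⟩ := pivot_ne hx.1 hjk hj hk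
  have hkS : k ∈ S := by
    by_contra h
    exact hjk (mem_nilTwoOn_rows hS hx h j)
  -- The shear takes `e_k` to `ε` times column `j` and fixes `e_j`; as `ε * ε = 1`, conjugating by
  -- its inverse turns column `j` into `ε e_k`.
  obtain ⟨A, hA, hA1, -, hA3⟩ := exists_borelOn_mulVec_eq (S := S) (k := k)
    (u := fun c => ε * x c j)
    (by
      rw [← mul_zero (ε * ε), ← col_isotropic hx.1 j, Finset.mul_sum]
      exact Finset.sum_congr rfl fun c _ => by ring)
    (fun i hi => by rw [hk i hi, mul_zero]) (mul_ne_zero hε0 hjk)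
    (fun i hi => ⟨fun h => hi (h ▸ hkS), fun h => hi (h ▸ hS k hkS), by
      rw [mem_nilTwoOn_rows hS hx (fun h => hi (by simpa using hS _ h)), mul_zero]⟩)
  have hA3 := hA3 j hkj.symm (fun h => hkj' (by rw [h, Fin.rev_rev]))
    (by rw [apply_rev_self hx.1, mul_zero])
  refine ⟨A⁻¹, inv_mem hA, _, conj_mem_nilTwoOn (inv_mem hA) hx, rfl, ?_, fun i hi a => ?_⟩
  · rw [inv_inv, ← Matrix.mulVec_mulVec, hA3, ← Matrix.mulVec_mulVec, ← inv_mulVec_eq hA1,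
      ← Matrix.mulVec_smul]
    congr 1
    ext c
    simp [← mul_assoc, hε]
  · rw [inv_inv, Matrix.mul_assoc, Matrix.mul_apply]
    refine Finset.sum_eq_zero fun c _ => ?_
    rw [Matrix.mul_apply, Finset.sum_eq_zero, mul_zero]
    intro d _
    rcases lt_or_ge d j with h | h
    · rw [hj d h, zero_mul]
    · rw [hA.1.2 d i (hi.trans_le h), mul_zero]

/-- Once column `j` is `ε e_k`, skewness makes `-ε` the leading entry of column `k*`, in row `j*`. A
second shear, built from that column, fixes `e_j`, `e_k` and `e_{k*}`, so it clears column `k*`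
without spoiling column `j`. -/
theorem exists_conj_pivot {n : ℕ} {S : Finset (Fin n)} (hS : ∀ i ∈ S, i.rev ∈ S)
    {x : Matrix (Fin n) (Fin n) ℂ} (hx : x ∈ nilTwoOn S) {j k : Fin n}
    (hjk : x k j ≠ 0) (hj : ∀ i, i < j → ∀ a, x a i = 0) (hk : ∀ a, k < a → x a j = 0)
    {ε : ℂ} (hε : ε * ε = 1) :
    ∃ g ∈ borelOn S, ∃ y ∈ nilTwoOn S, y = (g : Matrix (Fin n) (Fin n) ℂ) * x *
        ((g⁻¹ : GL (Fin n) ℂ) : Matrix (Fin n) (Fin n) ℂ) ∧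
      y *ᵥ Pi.single j 1 = ε • Pi.single k 1 ∧
      y *ᵥ Pi.single k.rev 1 = -ε • Pi.single j.rev 1 := by
  have hε0 : ε ≠ 0 := fun h => by simp [h] at hε
  obtain ⟨hkj, hkj', hkk, hjj⟩ := pivot_ne hx.1 hjk hj hk
  obtain ⟨g, hg, y, hy, rfl, hyj, hylt⟩ := exists_conj_first_column hS hx hjk hj hk hε
  set y := (g : Matrix (Fin n) (Fin n) ℂ) * x *
    ((g⁻¹ : GL (Fin n) ℂ) : Matrix (Fin n) (Fin n) ℂ) with hydef
  have hskew := mem_orthLie_iff_apply.mp hy.1.1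
  have hykj : y k j = ε := by
    have := congrFun hyj k
    rw [Matrix.mulVec_single_one] at this
    simpa using this
  have hyk : y *ᵥ Pi.single k 1 = 0 := by
    have h : ε • y *ᵥ Pi.single k 1 = 0 := by
      rw [← Matrix.mulVec_smul, ← hyj, Matrix.mulVec_mulVec, ← pow_two, hy.1.2, Matrix.zero_mulVec]
    exact (smul_eq_zero.mp h).resolve_left hε0
  have hjS : j.rev ∈ S := by
    apply hS
    by_contra h
    exact hjk (mulVec_single_one_eq_zero_iff.mp (hx.2 j h) k)
  -- Leading coefficient `1` makes the rescaling of the dual vector `e_j` trivial.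
  have hlead : -ε * y j.rev k.rev = 1 := by
    rw [hskew, Fin.rev_rev, Fin.rev_rev, hykj, neg_mul_neg, hε]
  obtain ⟨A, hA, hA1, hA2, hA3⟩ := exists_borelOn_mulVec_eq (S := S) (k := j.rev)
    (u := fun c => -ε * y c k.rev)
    (by
      rw [← mul_zero (ε * ε), ← col_isotropic hy.1 k.rev, Finset.mul_sum]
      exact Finset.sum_congr rfl fun c _ => by ring)
    (fun i hi => by
      rw [hskew, hylt i.rev (by rw [← Fin.rev_lt_rev, Fin.rev_rev]; exact hi), neg_zero, mul_zero])
    (by rw [hlead]; exact one_ne_zero)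
    (fun i hi => ⟨fun h => hi (h ▸ hjS), fun h => hi (h ▸ hS _ hjS), by
      rw [mem_nilTwoOn_rows hS hy (fun h => hi (by simpa using hS _ h)), mul_zero]⟩)
  rw [hlead, inv_one, one_smul, Fin.rev_rev] at hA2
  have hAk := hA3 k hkj' (by rwa [Fin.rev_rev]) (by
    rw [hskew, Fin.rev_rev, mulVec_single_one_eq_zero_iff.mp hyk, neg_zero, mul_zero])
  have hAk' := hA3 k.rev (fun h => hkj (Fin.rev_inj.mp h))
    (by rw [Fin.rev_rev]; exact fun h => hkj' (by rw [← h, Fin.rev_rev])) (by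
    have := apply_rev_self hy.1 k.rev
    rw [this, mul_zero])
  refine ⟨A⁻¹ * g, mul_mem (inv_mem hA) hg, _, conj_mem_nilTwoOn (inv_mem hA) hy, ?_, ?_, ?_⟩
  · rw [hydef, _root_.mul_inv_rev, Units.val_mul, Units.val_mul]
    simp only [Matrix.mul_assoc]
  · rw [inv_inv, ← Matrix.mulVec_mulVec, hA2, ← Matrix.mulVec_mulVec, hyj, Matrix.mulVec_smul,
      inv_mulVec_eq hAk]
  · rw [inv_inv, ← Matrix.mulVec_mulVec, hAk', ← Matrix.mulVec_mulVec, ← inv_mulVec_eq hA1,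
      ← Matrix.mulVec_smul]
    congr 1
    ext c
    simp [← mul_assoc, hε]

/-! ### Splitting off the pivot pair -/

theorem skewUnit_mem_orthLie {n : ℕ} (k j : Fin n) : skewUnit k j ∈ orthLie n := by
  rw [mem_orthLie_iff_apply]
  intro a b
  simp only [skewUnit, Matrix.sub_apply, Matrix.single_apply, Fin.rev_inj]
  have h1 : ∀ c d : Fin n, c = d.rev ↔ c.rev = d := fun c d => by rw [Fin.rev_eq_iff]
  simp only [h1, and_comm]
  ring

/-- The adjoint for the form reverses products and negates both factors, so it carries `x * y` to `y
* x`. -/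
theorem mul_eq_zero_comm_of_mem_orthLie {n : ℕ} {x y : Matrix (Fin n) (Fin n) ℂ}
    (hx : x ∈ orthLie n) (hy : y ∈ orthLie n) (h : x * y = 0) : y * x = 0 := by
  ext a b
  have h1 := congrFun (congrFun h b.rev) a.rev
  rw [Matrix.mul_apply, Matrix.zero_apply] at h1 ⊢
  rw [← h1, ← Equiv.sum_comp Fin.revPerm]
  refine Finset.sum_congr rfl fun c _ => ?_
  rw [mem_orthLie_iff_apply.mp hx b.rev, mem_orthLie_iff_apply.mp hy c, Fin.rev_rev]
  simp [mul_comm]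
 
theorem skewUnit_mul_self {n : ℕ} {k j : Fin n} (hkj : k ≠ j) (hkk : k ≠ k.rev)
    (hjj : j ≠ j.rev) : skewUnit k j * skewUnit k j = 0 := by
  simp [skewUnit, sub_mul, mul_sub, Matrix.single_mul_single_of_ne, hkj.symm, hkk.symm, hjj,
    hkj]

/-- Both `e_k` and `e_{j*}` are in the image of `y`, hence killed by it. They span the image of
`skewUnit k j`, so the two matrices annihilate each other on both sides and the difference still
squares to zero. -/
theorem sub_skewUnit_mem_nilTwoOn {n : ℕ} {S : Finset (Fin n)}
    {y : Matrix (Fin n) (Fin n) ℂ} (hy : y ∈ nilTwoOn S) {j k : Fin n}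
    (hkj : k ≠ j) (hkj' : k ≠ j.rev) (hkk : k ≠ k.rev) (hjj : j ≠ j.rev)
    {ε : ℂ} (hε : ε * ε = 1) (h1 : y *ᵥ Pi.single j 1 = ε • Pi.single k 1)
    (h2 : y *ᵥ Pi.single k.rev 1 = -ε • Pi.single j.rev 1) :
    y - ε • skewUnit k j ∈ nilTwoOn (S \ {j, j.rev, k, k.rev}) := by
  have hε0 : ε ≠ 0 := fun h => by simp [h] at hε
  have hyk : y *ᵥ Pi.single k 1 = 0 := by
    have h : ε • y *ᵥ Pi.single k 1 = 0 := by
      rw [← Matrix.mulVec_smul, ← h1, Matrix.mulVec_mulVec, ← pow_two, hy.1.2, Matrix.zero_mulVec]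
    exact (smul_eq_zero.mp h).resolve_left hε0
  have hyj : y *ᵥ Pi.single j.rev 1 = 0 := by
    have h : -ε • y *ᵥ Pi.single j.rev 1 = 0 := by
      rw [← Matrix.mulVec_smul, ← h2, Matrix.mulVec_mulVec, ← pow_two, hy.1.2, Matrix.zero_mulVec]
    exact (smul_eq_zero.mp h).resolve_left (neg_ne_zero.mpr hε0)
  have hmul : y * skewUnit k j = 0 := by
    rw [mulVec_single_one_eq_zero_iff] at hyk hyj
    ext a b
    simp [skewUnit, Matrix.mul_apply, mul_sub, Finset.sum_sub_distrib, Matrix.single_apply,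
      ite_and, hyk, hyj]
  have hmul' := mul_eq_zero_comm_of_mem_orthLie hy.1.1 (skewUnit_mem_orthLie k j) hmul
  refine ⟨⟨Submodule.sub_mem _ hy.1.1 (Submodule.smul_mem _ _ (skewUnit_mem_orthLie k j)), ?_⟩,
    fun i hi => ?_⟩
  · have := hy.1.2
    rw [pow_two] at this ⊢
    simp [sub_mul, mul_sub, hmul, hmul', this, skewUnit_mul_self hkj hkk hjj]
  · have hkj2 : k.rev ≠ j := fun h => hkj' (by rw [← h, Fin.rev_rev])
    by_cases hij : i = j
    · subst hij
      rw [Matrix.sub_mulVec, h1]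
      ext a
      simp [skewUnit, Matrix.single_apply, hkj2, Pi.single_apply, eq_comm]
    by_cases hik : i = k.rev
    · subst hik
      rw [Matrix.sub_mulVec, h2]
      ext a
      simp [skewUnit, Matrix.single_apply, hkj2.symm, Pi.single_apply, eq_comm]
    have h3 : skewUnit k j *ᵥ Pi.single i 1 = 0 := by
      ext a
      simp [skewUnit, Ne.symm hij, Ne.symm hik]
    rw [Matrix.sub_mulVec, Matrix.smul_mulVec, h3, smul_zero, sub_zero]
    by_cases hiS : i ∈ S
    · simp only [Finset.mem_sdiff, hiS, true_and, not_not, Finset.mem_insert,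
        Finset.mem_singleton] at hi
      rcases hi with h | rfl | rfl | h
      · exact absurd h hij
      · exact hyj
      · exact hyk
      · exact absurd h hik
    · exact hy.2 i hiS

/-- Row `i` records the pairings of the columns of `g` with `e_{i*}`, which the isometry `g` fixes.
-/
theorem borelOn_apply_of_notMem {n : ℕ} {S : Finset (Fin n)} (hS : ∀ i ∈ S, i.rev ∈ S)
    {g : GL (Fin n) ℂ} (hg : g ∈ borelOn S) {i : Fin n} (hi : i ∉ S) (b : Fin n) :
    (g : Matrix (Fin n) (Fin n) ℂ) i b = if i = b then 1 else 0 := by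
  have h := transpose_mul_antiDiag_mul_iff.mp hg.1.1 b i.rev
  have hc : ∀ c, (g : Matrix (Fin n) (Fin n) ℂ) c i.rev = if c = i.rev then 1 else 0 := by
    intro c
    have := congrFun (hg.2 i.rev fun h => hi (by simpa using hS _ h)) c
    rw [Matrix.mulVec_single_one] at this
    simpa [Pi.single_apply] using this
  simpa [hc, Fin.rev_inj] using h

theorem borelOn_conj_skewUnit {n : ℕ} {S : Finset (Fin n)} (hS : ∀ i ∈ S, i.rev ∈ S)
    {g : GL (Fin n) ℂ} (hg : g ∈ borelOn S) {k j : Fin n} (hk : k ∉ S) (hj : j ∉ S) :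
    (g : Matrix (Fin n) (Fin n) ℂ) * skewUnit k j *
      ((g⁻¹ : GL (Fin n) ℂ) : Matrix (Fin n) (Fin n) ℂ) = skewUnit k j := by
  have hrev : ∀ i ∉ S, i.rev ∉ S := fun i hi h => hi (by simpa using hS _ h)
  have hcol : ∀ i ∉ S, ∀ c, (g : Matrix (Fin n) (Fin n) ℂ) c i = if c = i then 1 else 0 := by
    intro i hi c
    have := congrFun (hg.2 i hi) c
    rw [Matrix.mulVec_single_one] at this
    simpa [Pi.single_apply] using this
  have hL : (g : Matrix (Fin n) (Fin n) ℂ) * skewUnit k j = skewUnit k j := by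
    ext a b
    simp [skewUnit, Matrix.mul_apply, mul_sub, Finset.sum_sub_distrib, Matrix.single_apply,
      ite_and, hcol _ hk, hcol _ (hrev _ hj), eq_comm]
    split_ifs <;> rfl
  have hg' := inv_mem hg
  have hR : skewUnit k j * ((g⁻¹ : GL (Fin n) ℂ) : Matrix (Fin n) (Fin n) ℂ) = skewUnit k j := by
    ext a b
    simp only [skewUnit, Matrix.mul_apply, sub_mul, Finset.sum_sub_distrib, Matrix.single_apply,
      ite_and, Matrix.sub_apply, ite_mul, one_mul, zero_mul, Finset.sum_ite_irrel,
      Finset.sum_const_zero, Finset.sum_ite_eq, Finset.mem_univ, if_true,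
      borelOn_apply_of_notMem hS hg' hj, borelOn_apply_of_notMem hS hg' (hrev _ hk)]
  rw [hL, hR]

/-! ### The matrices of arrows and of link patterns -/

/-- The row of the first matrix unit attached to an arrow. -/
def LinkArrow.row {l n : ℕ} (h : l ≤ n) (a : LinkArrow l) : Fin n :=
  if a.dotted = true ∧ a.source < a.target then (Fin.castLE h a.target).rev
  else Fin.castLE h a.target

/-- The column of the first matrix unit attached to an arrow. -/
def LinkArrow.col {l n : ℕ} (h : l ≤ n) (a : LinkArrow l) : Fin n :=
  if a.dotted = true ∧ ¬ a.source < a.target then (Fin.castLE h a.source).rev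
  else Fin.castLE h a.source

theorem LinkArrow.row_val {l n : ℕ} (h : l ≤ n) (a : LinkArrow l) :
    (a.row h).val = if a.dotted = true ∧ a.source.val < a.target.val then n - (a.target.val + 1)
      else a.target.val := by
  simp only [LinkArrow.row, Fin.lt_def]
  split_ifs <;> simp

theorem LinkArrow.col_val {l n : ℕ} (h : l ≤ n) (a : LinkArrow l) :
    (a.col h).val = if a.dotted = true ∧ ¬ a.source.val < a.target.val then
      n - (a.source.val + 1) else a.source.val := by
  simp only [LinkArrow.col, Fin.lt_def]
  split_ifs <;> simp

theorem LinkArrow.matrix_eq_skewUnit {l n : ℕ} (h : l ≤ n) (a : LinkArrow l) :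
    a.matrix h = skewUnit (a.row h) (a.col h) := by
  unfold LinkArrow.matrix LinkArrow.row LinkArrow.col skewUnit
  by_cases hd : a.dotted = true <;> by_cases hl : a.source < a.target <;> simp [hd, hl]

/-- The index `i` of a basis vector belongs to the vertex `v`. -/
def BelongsTo {l n : ℕ} (i : Fin n) (v : Fin l) : Prop :=
  i.val = v.val ∨ i.rev.val = v.val

theorem BelongsTo.rev {l n : ℕ} {i : Fin n} {v : Fin l} (h : BelongsTo i v) :
    BelongsTo i.rev v := by
  unfold BelongsTo at *
  rw [Fin.rev_rev]
  exact h.symm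

theorem BelongsTo.unique {l n : ℕ} (hn : 2 * l ≤ n) {i : Fin n} {v w : Fin l}
    (hv : BelongsTo i v) (hw : BelongsTo i w) : v = w := by
  simp only [BelongsTo, Fin.val_rev] at hv hw
  omega

theorem BelongsTo.ne_rev {l n : ℕ} (hn : 2 * l ≤ n) {i : Fin n} {v : Fin l}
    (hv : BelongsTo i v) : i ≠ i.rev := by
  simp only [BelongsTo, Fin.val_rev, ne_eq, Fin.ext_iff] at *
  omega

theorem LinkArrow.row_belongsTo {l n : ℕ} (h : l ≤ n) (a : LinkArrow l) :
    BelongsTo (a.row h) a.target := by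
  unfold LinkArrow.row BelongsTo
  split_ifs <;> simp

theorem LinkArrow.col_belongsTo {l n : ℕ} (h : l ≤ n) (a : LinkArrow l) :
    BelongsTo (a.col h) a.source := by
  unfold LinkArrow.col BelongsTo
  split_ifs <;> simp

/-- The position `(r, c)` is one of the two nonzero positions of the matrix of the arrow. -/
def LinkArrow.Occupies {l n : ℕ} (h : l ≤ n) (a : LinkArrow l) (r c : Fin n) : Prop :=
  (r = a.row h ∧ c = a.col h) ∨ (r = (a.col h).rev ∧ c = (a.row h).rev)

theorem LinkArrow.exists_row_touches {l n : ℕ} {h : l ≤ n} {a : LinkArrow l} {r c : Fin n}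
    (ha : a.Occupies h r c) : ∃ v, BelongsTo r v ∧ a.Touches v := by
  rcases ha with ⟨rfl, -⟩ | ⟨rfl, -⟩
  · exact ⟨_, a.row_belongsTo h, Or.inr rfl⟩
  · exact ⟨_, (a.col_belongsTo h).rev, Or.inl rfl⟩

theorem LinkArrow.exists_col_touches {l n : ℕ} {h : l ≤ n} {a : LinkArrow l} {r c : Fin n}
    (ha : a.Occupies h r c) : ∃ v, BelongsTo c v ∧ a.Touches v := by
  rcases ha with ⟨-, rfl⟩ | ⟨-, rfl⟩
  · exact ⟨_, a.col_belongsTo h, Or.inl rfl⟩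
  · exact ⟨_, (a.row_belongsTo h).rev, Or.inr rfl⟩

theorem LinkArrow.row_ne_col {l n : ℕ} (hn : 2 * l ≤ n) (h : l ≤ n) {a : LinkArrow l}
    (ha : a.source ≠ a.target) : a.row h ≠ a.col h ∧ a.row h ≠ (a.col h).rev :=
  ⟨fun e => ha ((a.col_belongsTo h).unique hn (e ▸ a.row_belongsTo h)),
    fun e => ha ((a.col_belongsTo h).rev.unique hn (e ▸ a.row_belongsTo h))⟩

theorem LinkArrow.matrix_apply_ne_zero_iff {l n : ℕ} (hn : 2 * l ≤ n) (h : l ≤ n)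
    {a : LinkArrow l} (ha : a.source ≠ a.target) (r c : Fin n) :
    a.matrix h r c ≠ 0 ↔ a.Occupies h r c := by
  have h1 := (LinkArrow.row_ne_col hn h ha).2
  rw [LinkArrow.matrix_eq_skewUnit, skewUnit, LinkArrow.Occupies, Matrix.sub_apply,
    Matrix.single_apply, Matrix.single_apply]
  by_cases h2 : a.row h = r ∧ a.col h = c
  · obtain ⟨rfl, rfl⟩ := h2
    simp [h1.symm]
  · rw [if_neg h2]
    have h3 : ¬ (r = a.row h ∧ c = a.col h) := fun h4 => h2 ⟨h4.1.symm, h4.2.symm⟩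
    simp only [h3, false_or, zero_sub, neg_ne_zero, ne_eq, ite_eq_right_iff, one_ne_zero,
      imp_false, not_not]
    exact ⟨fun h4 => ⟨h4.1.symm, h4.2.symm⟩, fun h4 => ⟨h4.1.symm, h4.2.symm⟩⟩

theorem Oolp.source_ne_target {l : ℕ} (p : Oolp l) {a : LinkArrow l} (ha : a ∈ p.arrows) :
    a.source ≠ a.target := by
  cases h : a.dotted
  · exact p.no_plain_loop a ha h
  · exact p.no_dotted_loop a ha h

/-- A row index belongs to one vertex, which touches one arrow; the two rows of an arrow belong to
its distinct endpoints. -/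
theorem Oolp.eq_of_occupies_row {l n : ℕ} (hn : 2 * l ≤ n) (h : l ≤ n) (p : Oolp l)
    {a b : LinkArrow l} (ha : a ∈ p.arrows) (hb : b ∈ p.arrows) {r c c' : Fin n}
    (h1 : a.Occupies h r c) (h2 : b.Occupies h r c') : a = b ∧ c = c' := by
  obtain ⟨v, hv, hv'⟩ := LinkArrow.exists_row_touches h1
  obtain ⟨w, hw, hw'⟩ := LinkArrow.exists_row_touches h2
  obtain rfl := p.touched v a ha b hb hv' (hv.unique hn hw ▸ hw')
  have h3 := (LinkArrow.row_ne_col hn h (p.source_ne_target ha)).2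
  refine ⟨rfl, ?_⟩
  rcases h1 with ⟨e1, rfl⟩ | ⟨e1, rfl⟩ <;> rcases h2 with ⟨e2, rfl⟩ | ⟨e2, rfl⟩
  · rfl
  · exact absurd (e1.symm.trans e2) h3
  · exact absurd (e2.symm.trans e1) h3
  · rfl

theorem Oolp.eq_of_occupies_col {l n : ℕ} (hn : 2 * l ≤ n) (h : l ≤ n) (p : Oolp l)
    {a b : LinkArrow l} (ha : a ∈ p.arrows) (hb : b ∈ p.arrows) {r r' c : Fin n}
    (h1 : a.Occupies h r c) (h2 : b.Occupies h r' c) : a = b ∧ r = r' := by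
  obtain ⟨v, hv, hv'⟩ := LinkArrow.exists_col_touches h1
  obtain ⟨w, hw, hw'⟩ := LinkArrow.exists_col_touches h2
  obtain rfl := p.touched v a ha b hb hv' (hv.unique hn hw ▸ hw')
  have h3 := (LinkArrow.row_ne_col hn h (p.source_ne_target ha)).2
  refine ⟨rfl, ?_⟩
  rcases h1 with ⟨rfl, e1⟩ | ⟨rfl, e1⟩ <;> rcases h2 with ⟨rfl, e2⟩ | ⟨rfl, e2⟩
  · rfl
  · exact absurd (by rw [e1.symm.trans e2, Fin.rev_rev]) h3
  · exact absurd (by rw [e2.symm.trans e1, Fin.rev_rev]) h3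
  · rfl

theorem Oolp.matrix_apply_ne_zero_iff {l n : ℕ} (hn : 2 * l ≤ n) (h : l ≤ n) (p : Oolp l)
    (r c : Fin n) : p.matrix h r c ≠ 0 ↔ ∃ a ∈ p.arrows, a.Occupies h r c := by
  rw [Oolp.matrix, Matrix.sum_apply]
  constructor
  · intro hne
    obtain ⟨a, ha, ha'⟩ := Finset.exists_ne_zero_of_sum_ne_zero hne
    exact ⟨a, ha, (LinkArrow.matrix_apply_ne_zero_iff hn h (p.source_ne_target ha) r c).mp ha'⟩
  · rintro ⟨a, ha, ha'⟩
    rw [Finset.sum_eq_single a]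
    · exact (LinkArrow.matrix_apply_ne_zero_iff hn h (p.source_ne_target ha) r c).mpr ha'
    · intro b hb hba
      by_contra hne
      exact hba (p.eq_of_occupies_row hn h hb ha
        ((LinkArrow.matrix_apply_ne_zero_iff hn h (p.source_ne_target hb) r c).mp hne) ha').1
    · exact fun h2 => absurd ha h2

/-- A nonzero term of the square would make an occupied column meet an occupied row at one vertex,
hence within a single arrow, whose row and column indices never match up. -/
theorem Oolp.matrix_mem_orthNilTwo {l n : ℕ} (hn : 2 * l ≤ n) (h : l ≤ n) (p : Oolp l) :
    p.matrix h ∈ orthNilTwo n := by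
  constructor
  · refine Submodule.sum_mem _ fun a _ => ?_
    rw [LinkArrow.matrix_eq_skewUnit]
    exact skewUnit_mem_orthLie _ _
  · ext r c
    rw [pow_two, Matrix.mul_apply, Matrix.zero_apply]
    refine Finset.sum_eq_zero fun m _ => ?_
    by_contra hne
    obtain ⟨a, ha, ha'⟩ := (p.matrix_apply_ne_zero_iff hn h r m).mp (left_ne_zero_of_mul hne)
    obtain ⟨b, hb, hb'⟩ := (p.matrix_apply_ne_zero_iff hn h m c).mp (right_ne_zero_of_mul hne)
    obtain ⟨v, hv, hv'⟩ := LinkArrow.exists_col_touches ha'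
    obtain ⟨w, hw, hw'⟩ := LinkArrow.exists_row_touches hb'
    obtain rfl := p.touched v a ha b hb hv' (hv.unique hn hw ▸ hw')
    have h3 := LinkArrow.row_ne_col hn h (p.source_ne_target ha)
    rcases ha' with ⟨-, e1⟩ | ⟨-, e1⟩ <;> rcases hb' with ⟨e2, -⟩ | ⟨e2, -⟩
    · exact h3.1 (e2.symm.trans e1)
    · exact (a.col_belongsTo h).ne_rev hn (e1.symm.trans e2)
    · exact (a.row_belongsTo h).ne_rev hn (e2.symm.trans e1)
    · exact h3.1 (Fin.rev_inj.mp (e1.symm.trans e2))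

/-- The quadrant of a position gives the dot, and for dotted arrows the direction. A dotted arrow
has both positions in one quadrant; comparing `source` with `target` tells them apart. -/
theorem LinkArrow.eq_of_occupies {l n : ℕ} (hn : 2 * l ≤ n) (h : l ≤ n) {a b : LinkArrow l}
    (ha : a.source ≠ a.target) (hb : b.source ≠ b.target)
    (hab : b.Occupies h (a.row h) (a.col h)) : a = b := by
  obtain ⟨s, t, d⟩ := a
  obtain ⟨s', t', d'⟩ := b
  simp only [ne_eq, Fin.ext_iff] at ha hb
  simp only [LinkArrow.Occupies, Fin.ext_iff, LinkArrow.row_val, LinkArrow.col_val,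
    Fin.val_rev] at hab
  rw [LinkArrow.mk.injEq, Fin.ext_iff, Fin.ext_iff]
  cases d <;> cases d' <;>
    simp only [Bool.false_eq_true, false_and, if_false, true_and, and_true, and_false,
      reduceCtorEq] at hab ⊢ <;> (try split_ifs at hab) <;> omega

theorem Oolp.arrows_subset_of_support {l n : ℕ} (hn : 2 * l ≤ n) (h : l ≤ n) {p q : Oolp l}
    (hpq : ∀ r c, p.matrix h r c ≠ 0 → q.matrix h r c ≠ 0) : p.arrows ⊆ q.arrows := by
  intro a ha
  obtain ⟨b, hb, hb'⟩ := (q.matrix_apply_ne_zero_iff hn h _ _).mp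
    (hpq _ _ ((p.matrix_apply_ne_zero_iff hn h _ _).mpr ⟨a, ha, Or.inl ⟨rfl, rfl⟩⟩))
  rwa [LinkArrow.eq_of_occupies hn h (p.source_ne_target ha) (q.source_ne_target hb) hb']

theorem exists_arrow_skewUnit {l n : ℕ} (hn : n = 2 * l ∨ n = 2 * l + 1) (h : l ≤ n) {k j : Fin n}
    (hkj : k ≠ j) (hkj' : k ≠ j.rev) (hkk : k ≠ k.rev) (hjj : j ≠ j.rev) :
    ∃ a : LinkArrow l, a.source ≠ a.target ∧
      (∃ ε : ℂ, ε * ε = 1 ∧ a.matrix h = ε • skewUnit k j) ∧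
      ∀ v, a.Touches v → BelongsTo k v ∨ BelongsTo j v := by
  -- It suffices to name an arrow occupying `(k, j)`: the sign is `1` if this is its first position
  -- and `-1` if it is the mirror one.
  have key : ∀ a : LinkArrow l, a.Occupies h k j → ∃ a : LinkArrow l, a.source ≠ a.target ∧
      (∃ ε : ℂ, ε * ε = 1 ∧ a.matrix h = ε • skewUnit k j) ∧
      ∀ v, a.Touches v → BelongsTo k v ∨ BelongsTo j v := by
    intro a ha
    have h1 := a.row_belongsTo h
    have h2 := a.col_belongsTo h
    rcases ha with ⟨e1, e2⟩ | ⟨e1, e2⟩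
    · rw [← e1] at h1
      rw [← e2] at h2
      refine ⟨a, fun e => ?_, ⟨1, one_mul 1, by rw [a.matrix_eq_skewUnit, ← e1, ← e2, one_smul]⟩,
        ?_⟩
      · rw [e] at h2
        simp only [BelongsTo, Fin.val_rev, ne_eq, Fin.ext_iff] at *
        omega
      · rintro v (rfl | rfl)
        exacts [Or.inr h2, Or.inl h1]
    · rw [← Fin.rev_rev (a.row h), ← e2] at h1
      rw [← Fin.rev_rev (a.col h), ← e1] at h2
      refine ⟨a, fun e => ?_, ⟨-1, by norm_num, ?_⟩, ?_⟩
      · rw [e] at h2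
        simp only [BelongsTo, Fin.val_rev, ne_eq, Fin.ext_iff] at *
        omega
      · rw [a.matrix_eq_skewUnit, e1, e2]
        simp [skewUnit]
      · have h1 := h1.rev
        have h2 := h2.rev
        rw [Fin.rev_rev] at h1 h2
        rintro v (rfl | rfl)
        exacts [Or.inl h2, Or.inr h1]
  simp only [LinkArrow.Occupies, Fin.ext_iff, LinkArrow.row_val, LinkArrow.col_val,
    Fin.val_rev] at key
  simp only [ne_eq, Fin.ext_iff, Fin.val_rev] at hkj hkj' hkk hjj
  rcases lt_or_ge k.val l with hk | hk <;> rcases lt_or_ge j.val l with hj | hj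
  · exact key ⟨⟨j, hj⟩, ⟨k, hk⟩, false⟩ (by simp)
  -- In an off-diagonal quadrant the arrow is dotted and its direction is forced, so comparing the
  -- two vertices decides which end is the source.
  · rcases lt_or_ge k.val (n - (j + 1)) with hlt | hlt
    · exact key ⟨⟨n - (j + 1), by omega⟩, ⟨k, hk⟩, true⟩
        (by simp only [true_and]; split_ifs <;> omega)
    · exact key ⟨⟨k, hk⟩, ⟨n - (j + 1), by omega⟩, true⟩
        (by simp only [true_and]; split_ifs <;> omega)
  · rcases lt_or_ge j.val (n - (k + 1)) with hlt | hlt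
    · exact key ⟨⟨j, hj⟩, ⟨n - (k + 1), by omega⟩, true⟩
        (by simp only [true_and]; split_ifs <;> omega)
    · exact key ⟨⟨n - (k + 1), by omega⟩, ⟨j, hj⟩, true⟩
        (by simp only [true_and]; split_ifs <;> omega)
  · exact key ⟨⟨n - (k + 1), by omega⟩, ⟨n - (j + 1), by omega⟩, false⟩
        (by simp only [Bool.false_eq_true, false_and, if_false]; omega)

/-! ### Orbits and link patterns -/

theorem LinkArrow.touches_self {l : ℕ} (a : LinkArrow l) : a.Touches a.source := Or.inl rfl

/-- The clause confining the touched vertices to `S` makes the pivot's arrow disjoint from those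
produced on the smaller set. -/
theorem exists_borelOn_conj_eq_matrix {l n : ℕ} (hn : n = 2 * l ∨ n = 2 * l + 1) (h : l ≤ n)
    (S : Finset (Fin n)) : (∀ i ∈ S, i.rev ∈ S) → ∀ x ∈ nilTwoOn S,
      ∃ g ∈ borelOn S, ∃ p : Oolp l,
        (∀ a ∈ p.arrows, ∀ v, a.Touches v → ∀ i : Fin n, BelongsTo i v → i ∈ S) ∧
        (g : Matrix (Fin n) (Fin n) ℂ) * x * ((g⁻¹ : GL (Fin n) ℂ) : Matrix (Fin n) (Fin n) ℂ) =
          p.matrix h := by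
  classical
  induction S using Finset.strongInduction with
  | H S ih =>
  intro hS x hx
  by_cases hx0 : x = 0
  · refine ⟨1, one_mem _, ⟨⟨∅, by simp, by simp⟩, by simp⟩, by simp, ?_⟩
    simp [hx0, Oolp.matrix]
  obtain ⟨j, k, hjk, hj, hk⟩ := exists_pivot hx0
  obtain ⟨hkj, hkj', hkk, hjj⟩ := pivot_ne hx.1 hjk hj hk
  obtain ⟨a, hane, ⟨ε, hε, hamat⟩, hatouch⟩ := exists_arrow_skewUnit hn h hkj hkj' hkk hjj
  obtain ⟨g, hg, y, hy, hyx, h1, h2⟩ := exists_conj_pivot hS hx hjk hj hk hε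
  have hy' := sub_skewUnit_mem_nilTwoOn hy hkj hkj' hkk hjj hε h1 h2
  have hjS : j ∈ S := by
    by_contra hc
    exact hjk (mulVec_single_one_eq_zero_iff.mp (hx.2 j hc) k)
  have hkS : k ∈ S := by
    by_contra hc
    exact hjk (mem_nilTwoOn_rows hS hx hc j)
  set T := S \ {j, j.rev, k, k.rev} with hT
  have hTS : T ⊆ S := Finset.sdiff_subset
  have hjT : j ∉ T := by simp [hT]
  have hkT : k ∉ T := by simp [hT]
  have hTrev : ∀ i ∈ T, i.rev ∈ T := by
    intro i hi
    simp only [hT, Finset.mem_sdiff, Finset.mem_insert, Finset.mem_singleton, not_or,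
      Fin.rev_eq_iff, Fin.rev_rev] at hi ⊢
    exact ⟨hS i hi.1, hi.2.2.1, hi.2.1, hi.2.2.2.2, hi.2.2.2.1⟩
  obtain ⟨g', hg', p, hpT, hp⟩ := ih T
    (Finset.ssubset_iff_subset_ne.mpr ⟨hTS, fun e => hjT (e ▸ hjS)⟩) hTrev _ hy'
  have haT : ∀ v, a.Touches v → ∃ i ∉ T, BelongsTo i v := fun v hv =>
    (hatouch v hv).elim (fun hb => ⟨k, hkT, hb⟩) fun hb => ⟨j, hjT, hb⟩
  have hdisj : ∀ b ∈ p.arrows, ∀ v, a.Touches v → ¬ b.Touches v := by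
    intro b hb v hv hv'
    obtain ⟨i, hi, hiv⟩ := haT v hv
    exact hi (hpT b hb v hv' i hiv)
  have hap : a ∉ p.arrows := fun hc => hdisj a hc _ a.touches_self a.touches_self
  have hloop : ∀ b ∈ insert a p.arrows, b.source ≠ b.target := by
    intro b hb
    rcases Finset.mem_insert.mp hb with rfl | hb
    · exact hane
    · exact p.source_ne_target hb
  refine ⟨g' * g, mul_mem (borelOn_mono hTS hg') hg,
    ⟨⟨insert a p.arrows, ?_, fun b hb _ => hloop b hb⟩, fun b hb _ => hloop b hb⟩, ?_, ?_⟩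
  · intro v b hb c hc hbv hcv
    rcases Finset.mem_insert.mp hb with rfl | hb' <;>
      rcases Finset.mem_insert.mp hc with rfl | hc'
    · rfl
    · exact absurd hcv (hdisj c hc' v hbv)
    · exact absurd hbv (hdisj b hb' v hcv)
    · exact p.touched v b hb' c hc' hbv hcv
  · intro b hb v hbv i hi
    rcases Finset.mem_insert.mp hb with rfl | hb
    · have hmem : ∀ m ∈ S, BelongsTo m v → i ∈ S := by
        intro m hm hmv
        have : i = m ∨ i = m.rev := by
          simp only [BelongsTo, Fin.ext_iff, Fin.val_rev] at hi hmv ⊢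
          omega
        rcases this with rfl | rfl
        exacts [hm, hS m hm]
      exact (hatouch v hbv).elim (hmem k hkS) (hmem j hjS)
    · exact hTS (hpT b hb v hbv i hi)
  · have hconj := borelOn_conj_skewUnit hTrev hg' hkT hjT
    calc ((g' * g : GL (Fin n) ℂ) : Matrix (Fin n) (Fin n) ℂ) * x *
          (((g' * g)⁻¹ : GL (Fin n) ℂ) : Matrix (Fin n) (Fin n) ℂ)
        = (g' : Matrix (Fin n) (Fin n) ℂ) * (ε • skewUnit k j + (y - ε • skewUnit k j)) *
          ((g'⁻¹ : GL (Fin n) ℂ) : Matrix (Fin n) (Fin n) ℂ) := by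
          rw [add_sub_cancel, hyx, _root_.mul_inv_rev, Units.val_mul, Units.val_mul]
          simp only [Matrix.mul_assoc]
      _ = ε • skewUnit k j + p.matrix h := by
          rw [Matrix.mul_add, Matrix.add_mul, hp, Matrix.mul_smul, Matrix.smul_mul, hconj]
      _ = _ := by
          rw [Oolp.matrix, Oolp.matrix, Finset.sum_insert hap, hamat]

/-- Partial monomial matrices that are conjugate by an upper triangular matrix have comparable
supports. -/
theorem support_subset_of_upper_conj {n : ℕ} {g : GL (Fin n) ℂ} (hg : g ∈ upperGL n)
    {x y : Matrix (Fin n) (Fin n) ℂ}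
    (hxy : (g : Matrix (Fin n) (Fin n) ℂ) * x = y * (g : Matrix (Fin n) (Fin n) ℂ))
    (hrow : ∀ r c c', x r c ≠ 0 → x r c' ≠ 0 → c = c')
    (hcol : ∀ r r' c, x r c ≠ 0 → x r' c ≠ 0 → r = r') (j : Fin n)
    (hlt : ∀ c < j, ∀ r, y r c ≠ 0 → x r c ≠ 0) (i : Fin n) (hij : x i j ≠ 0) : y i j ≠ 0 := by
  have hdiag : (g : Matrix (Fin n) (Fin n) ℂ) i i ≠ 0 := by
    have hdet : (g : Matrix (Fin n) (Fin n) ℂ).det ≠ 0 :=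
      ((Matrix.isUnit_iff_isUnit_det _).mp g.isUnit).ne_zero
    rw [Matrix.det_of_isUpperTriangular fun a b hab => hg a b hab] at hdet
    exact Finset.prod_ne_zero_iff.mp hdet i (Finset.mem_univ i)
  -- Column `j` of `x` has only the entry at `i`, so this product is `g i i * x i j`.
  have h1 : ((g : Matrix (Fin n) (Fin n) ℂ) * x) i j ≠ 0 := by
    rw [Matrix.mul_apply, Finset.sum_eq_single i]
    · exact mul_ne_zero hdiag hij
    · intro c _ hc
      by_contra hne
      exact hc (hcol c i j (right_ne_zero_of_mul hne) hij)
    · simp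
  rw [hxy, Matrix.mul_apply] at h1
  obtain ⟨c, -, hc⟩ := Finset.exists_ne_zero_of_sum_ne_zero h1
  have hy := left_ne_zero_of_mul hc
  -- An entry of `y` at `(i, c)` with `c < j` would give `x` a second entry in row `i`; `c > j`
  -- contradicts triangularity.
  rcases lt_trichotomy c j with hcj | rfl | hcj
  · exact absurd (hrow i c j (hlt c hcj i hy) hij) hcj.ne
  · exact hy
  · exact absurd (hg c j hcj) (right_ne_zero_of_mul hc)

theorem support_iff_of_upper_conj {n : ℕ} {g : GL (Fin n) ℂ} (hg : g ∈ upperGL n)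
    {x y : Matrix (Fin n) (Fin n) ℂ}
    (hxy : (g : Matrix (Fin n) (Fin n) ℂ) * x = y * (g : Matrix (Fin n) (Fin n) ℂ))
    (hrow : ∀ r c c', x r c ≠ 0 → x r c' ≠ 0 → c = c')
    (hcol : ∀ r r' c, x r c ≠ 0 → x r' c ≠ 0 → r = r')
    (hrow' : ∀ r c c', y r c ≠ 0 → y r c' ≠ 0 → c = c')
    (hcol' : ∀ r r' c, y r c ≠ 0 → y r' c ≠ 0 → r = r') (j : Fin n) :
    ∀ i, x i j ≠ 0 ↔ y i j ≠ 0 := by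
  have hyx : ((g⁻¹ : GL (Fin n) ℂ) : Matrix (Fin n) (Fin n) ℂ) * y =
      x * ((g⁻¹ : GL (Fin n) ℂ) : Matrix (Fin n) (Fin n) ℂ) := by
    rw [Units.inv_mul_eq_iff_eq_mul, ← Matrix.mul_assoc, hxy, Units.mul_inv_cancel_right]
  induction j using WellFoundedLT.induction with
  | ind j ih =>
  exact fun i => ⟨support_subset_of_upper_conj hg hxy hrow hcol j
      (fun c hc r => (ih c hc r).mpr) i,
    support_subset_of_upper_conj (inv_mem hg) hyx hrow' hcol' j
      (fun c hc r => (ih c hc r).mp) i⟩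

theorem Oolp.eq_of_upper_conj {l n : ℕ} (hn : 2 * l ≤ n) (h : l ≤ n) {p q : Oolp l}
    {g : GL (Fin n) ℂ} (hg : g ∈ upperGL n)
    (hpq : (g : Matrix (Fin n) (Fin n) ℂ) * p.matrix h =
      q.matrix h * (g : Matrix (Fin n) (Fin n) ℂ)) : p = q := by
  have hrow : ∀ (p : Oolp l) (r c c' : Fin n), p.matrix h r c ≠ 0 → p.matrix h r c' ≠ 0 →
      c = c' := by
    intro p r c c' h1 h2
    obtain ⟨a, ha, ha'⟩ := (p.matrix_apply_ne_zero_iff hn h r c).mp h1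
    obtain ⟨b, hb, hb'⟩ := (p.matrix_apply_ne_zero_iff hn h r c').mp h2
    exact (p.eq_of_occupies_row hn h ha hb ha' hb').2
  have hcol : ∀ (p : Oolp l) (r r' c : Fin n), p.matrix h r c ≠ 0 → p.matrix h r' c ≠ 0 →
      r = r' := by
    intro p r r' c h1 h2
    obtain ⟨a, ha, ha'⟩ := (p.matrix_apply_ne_zero_iff hn h r c).mp h1
    obtain ⟨b, hb, hb'⟩ := (p.matrix_apply_ne_zero_iff hn h r' c).mp h2
    exact (p.eq_of_occupies_col hn h ha hb ha' hb').2
  have hs := support_iff_of_upper_conj hg hpq (hrow p) (hcol p) (hrow q) (hcol q)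
  have harr : p.arrows = q.arrows := Finset.Subset.antisymm
    (Oolp.arrows_subset_of_support hn h fun r c => (hs c r).mp)
    (Oolp.arrows_subset_of_support hn h fun r c => (hs c r).mpr)
  exact Oolp.ext harr

theorem range_toSolp (l : ℕ) : Set.range (Oolp.toSolp : Oolp l → Solp l) =
    {p : Solp l | ∀ a ∈ p.arrows, a.source ≠ a.target} := by
  ext p
  constructor
  · rintro ⟨q, rfl⟩ a ha
    exact q.source_ne_target ha
  · exact fun hp => ⟨⟨p, fun a ha _ => hp a ha⟩, rfl⟩

theorem mainTheorem2 (l n : ℕ) (hn : n = 2 * l ∨ n = 2 * l + 1) :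
    Set.range (Oolp.toSolp : Oolp l → Solp l) =
        {p : Solp l | ∀ a ∈ p.arrows, a.source ≠ a.target} ∧
      ∃ Φ : OrthOrbits n ≃ Oolp l,
        ∀ p : Oolp l, ∃ hp : p.matrix (le_of_eq_two_mul_or hn) ∈ orthNilTwo n,
          Φ (Quotient.mk (MulAction.orbitRel (orthBorel n) (orthNilTwo n))
            ⟨p.matrix (le_of_eq_two_mul_or hn), hp⟩) = p := by
  have h := le_of_eq_two_mul_or hn
  have hn2 : 2 * l ≤ n := by omega
  let F : Oolp l → OrthOrbits n := fun p =>
    Quotient.mk (MulAction.orbitRel (orthBorel n) (orthNilTwo n))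
      ⟨p.matrix h, p.matrix_mem_orthNilTwo hn2 h⟩
  have hF : Function.Bijective F := by
    constructor
    · intro p q hpq
      obtain ⟨g, hg⟩ := MulAction.orbitRel_apply.mp (Quotient.exact hpq)
      have hg' : (g.1 : Matrix (Fin n) (Fin n) ℂ) * q.matrix h *
          ((g.1⁻¹ : GL (Fin n) ℂ) : Matrix (Fin n) (Fin n) ℂ) = p.matrix h :=
        congrArg Subtype.val hg
      exact (Oolp.eq_of_upper_conj hn2 h g.2.2 (by
        rw [← hg', Units.inv_mul_cancel_right])).symm
    · intro o
      obtain ⟨x, rfl⟩ := Quotient.exists_rep o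
      obtain ⟨g, hg, p, -, hp⟩ := exists_borelOn_conj_eq_matrix hn h Finset.univ (by simp) x.1
        ⟨x.2, by simp⟩
      exact ⟨p, Quotient.sound (MulAction.orbitRel_apply.mpr ⟨⟨g, hg.1⟩, Subtype.ext hp⟩)⟩
  exact ⟨range_toSolp l, (Equiv.ofBijective F hF).symm, fun p =>
    ⟨p.matrix_mem_orthNilTwo hn2 h, (Equiv.ofBijective F hF).symm_apply_apply p⟩⟩
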